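/- All graphs are finite and simple. In the game of Cops and Robbers with $k$ cops on a graph $G$, in round $0$ each cop chooses a vertex and then, knowing this, the robber chooses a vertex. In each round $t\ge 1$ first every cop stays in place or moves along an edge, and then the robber stays in place or moves along an edge; both sides have perfect information, and several cops may share a vertex. The robber is captured in the first round during which some cop occupies the same vertex as the robber. Let $\operatorname{capt}_k(G)\in\mathbb N\cup\{\infty\}$ be the round in which the robber is captured when the cops play to minimize and the robber plays to maximize it ($\infty$ if the robber can avoid capture forever). A vertex $v$ is damaged if, at the beginning of some round $t\ge1$, the robber has not been captured and occupies $v$, and the robber is not captured in round $t$. Let $\operatorname{dmg}_k(G)$ be the number of damaged vertices when the cops play to minimize and the robber plays to maximize it. For a graph $G$ on $m\ge 1$ vertices, put \[\operatorname{th}_c(G)=\min_{1\le k\le m}\{k+\operatorname{capt}_k(G)\},\qquad \operatorname{th}_d(G)=\min_{1\le k\le m}\{k+\operatorname{dmg}_k(G)\}.\] For each integer $n\ge 7$, let $H_n$ be the graph with vertex set $\{1,2,\dots,n\}$ whose edges are \[12,\ 13,\ 15,\ 16,\ 23,\ 24,\ 25,\ 34,\ 36,\ 45,\ 46,\ 47,\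 57,\ 67\] together with the edges $\{i,i+1\}$ for $7\le i\le n-1$. **Corollary.** For every integer $a\ge 3$, if $n=2a^2-2a+6$, then $\operatorname{th}_d(H_n)<\operatorname{th}_c(H_n)-1$. -/

import Mathlib

namespace CopsRobbers

variable {V : Type*}

/-- A strategy for `k` cops on `G`. `pos h` gives the positions of the cops after their turn in
round `h.length`, where the list `h` records the robber's positions at the end of all the earlier
rounds, the most recent one first. In particular `pos []` is the initial placement in round `0`
(the robber then places himself knowing it). In every later round each cop stays in place or moves
along an edge. Several cops may share a vertex. -/
structure CopStrategy (G : SimpleGraph V) (k : ℕ) where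
  pos : List V → Fin k → V
  legal : ∀ (h : List V) (v : V) (i : Fin k),
    pos (v :: h) i = pos h i ∨ G.Adj (pos h i) (pos (v :: h) i)

/-- A course of play of the robber: `pos t` is his position at the end of round `t`; `pos 0` is his
initial placement, and in every later round he stays in place or moves along an edge. -/
structure RobberPlay (G : SimpleGraph V) where
  pos : ℕ → V
  legal : ∀ t : ℕ, pos (t + 1) = pos t ∨ G.Adj (pos t) (pos (t + 1))

/-- The robber's positions at the end of rounds `0, …, t - 1`, the most recent one first. -/
def RobberPlay.history {G : SimpleGraph V} (r : RobberPlay G) : ℕ → List V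
  | 0 => []
  | t + 1 => r.pos t :: r.history t

/-- The position of cop `i` at the end of round `t` when the cops follow `σ` and the robber
plays `r`. -/
def copPos {G : SimpleGraph V} {k : ℕ} (σ : CopStrategy G k) (r : RobberPlay G) (t : ℕ)
    (i : Fin k) : V :=
  σ.pos (r.history t) i

/-- During round `t` a cop and the robber occupy the same vertex: either at the end of the round
(after the robber's turn) or, for `t ≥ 1`, after the cops' turn and before the robber's. -/
def MeetAt {G : SimpleGraph V} {k : ℕ} (σ : CopStrategy G k) (r : RobberPlay G) (t : ℕ) : Prop :=
  (∃ i, copPos σ r t i = r.pos t) ∨ ∃ s, t = s + 1 ∧ ∃ i, copPos σ r t i = r.pos s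

/-- The round in which the robber is captured (`⊤` if he never is). -/
noncomputable def captureRound {G : SimpleGraph V} {k : ℕ} (σ : CopStrategy G k)
    (r : RobberPlay G) : ℕ∞ :=
  ⨅ (t : ℕ) (_ : MeetAt σ r t), (t : ℕ∞)

/-- The `k`-capture time: the cops minimize, and the robber maximizes, the round of capture. -/
noncomputable def captureTime (G : SimpleGraph V) (k : ℕ) : ℕ∞ :=
  ⨅ σ : CopStrategy G k, ⨆ r : RobberPlay G, captureRound σ r

/-- The set of damaged vertices: `v` is damaged if the robber is on `v` when some round `t + 1`
begins (that is, at the end of round `t`), and he is captured neither before nor in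
round `t + 1`. -/
def damagedSet {G : SimpleGraph V} {k : ℕ} (σ : CopStrategy G k) (r : RobberPlay G) : Set V :=
  {v | ∃ t : ℕ, r.pos t = v ∧ ∀ s ≤ t + 1, ¬ MeetAt σ r s}

/-- The `k`-damage number: the cops minimize, and the robber maximizes, the number of damaged
vertices. -/
noncomputable def damageNumber (G : SimpleGraph V) (k : ℕ) : ℕ∞ :=
  ⨅ σ : CopStrategy G k, ⨆ r : RobberPlay G, (damagedSet σ r).encard

/-- The cop throttling number `min {k + capt_k(G) : 1 ≤ k ≤ |V(G)|}`. -/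
noncomputable def copThrottling [Fintype V] (G : SimpleGraph V) : ℕ∞ :=
  ⨅ k ∈ Set.Icc 1 (Fintype.card V), ((k : ℕ∞) + captureTime G k)

/-- The damage throttling number `min {k + dmg_k(G) : 1 ≤ k ≤ |V(G)|}`. -/
noncomputable def damageThrottling [Fintype V] (G : SimpleGraph V) : ℕ∞ :=
  ⨅ k ∈ Set.Icc 1 (Fintype.card V), ((k : ℕ∞) + damageNumber G k)

/-- The edges of `H_7`, on the vertices labelled `1, …, 7`. -/
def edgesH7 : List (ℕ × ℕ) :=
  [(1, 2), (1, 3), (1, 5), (1, 6), (2, 3), (2, 4), (2, 5), (3, 4), (3, 6), (4, 5), (4, 6), (4, 7),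
    (5, 7), (6, 7)]

/-- The graph `H_n` (`n ≥ 7`) on the vertices labelled `1, …, n`: the graph `H_7` together with the
path `7, 8, …, n`. The vertex with label `x` is the element `x - 1` of `Fin n`. -/
def graphH (n : ℕ) : SimpleGraph (Fin n) :=
  SimpleGraph.fromRel fun i j =>
    (i.val + 1, j.val + 1) ∈ edgesH7 ∨ (7 ≤ i.val + 1 ∧ j.val = i.val + 1)

end CopsRobbers

namespace CopsRobbers

/-! The proof shows `damageThrottling` is at most 2a - 2 and `copThrottling` is at least 2a. The gap
arises because a single cop cannot catch a robber in H_7, while a single cop on vertex 4 keeps the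
damage there to one vertex: 4 is adjacent to all of H_7 except 1, so the robber can only sit on 1.

Damage (`damageNumber_graphH_le`): use a cops, one on vertex 4 and the others on the path with 2a -
2 vertices between neighbours and a - 1 vertices beyond the last. A robber on the path is squeezed
(`squeeze`) and damages at most a - 2 vertices; in H_7 he damages at most one.

Capture (`lt_captureTime_graphH`): suppose k cops try to win within r rounds. If two of them start
near H_7, the other k - 2 leave some path vertex out of reach, and the robber waits there. Otherwise
at most one is near, and the robber evades it because only the end of the path is a corner. The
required inequality on n for k + r + 1 = 2a reduces to 4(k - 1)r ≤ (k - 1 + r)^2. -/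

/-- The relation on indices (labels shifted by one) that underlies the graph `H_n`. -/
def IndexRel (i j : ℕ) : Prop :=
  (i + 1, j + 1) ∈ edgesH7 ∨ (7 ≤ i + 1 ∧ j = i + 1)

instance : DecidableRel IndexRel := fun i j => by unfold IndexRel; infer_instance

/-- Adjacency of `H_n` in terms of indices. -/
def IndexAdj (i j : ℕ) : Prop :=
  i ≠ j ∧ (IndexRel i j ∨ IndexRel j i)

instance : DecidableRel IndexAdj := fun i j => by unfold IndexAdj; infer_instance

theorem graphH_adj {n : ℕ} (u v : Fin n) : (graphH n).Adj u v ↔ IndexAdj u.val v.val := by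
  simp [graphH, IndexAdj, IndexRel, SimpleGraph.fromRel_adj, Fin.ext_iff]

theorem IndexRel.le {i j : ℕ} (h : IndexRel i j) : (i ≤ 6 ∧ j ≤ 6) ∨ (6 ≤ i ∧ j = i + 1) := by
  rcases h with h | h
  · simp only [edgesH7, List.mem_cons, Prod.mk.injEq, List.not_mem_nil, or_false] at h
    omega
  · omega

theorem IndexAdj.le {i j : ℕ} (h : IndexAdj i j) :
    (i ≤ 6 ∧ j ≤ 6) ∨ (6 ≤ i ∧ j = i + 1) ∨ (6 ≤ j ∧ i = j + 1) := by
  rcases h.2 with h | h <;> have := h.le <;> omega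

theorem IndexAdj.succ {i : ℕ} (h : 6 ≤ i) : IndexAdj i (i + 1) :=
  ⟨by omega, Or.inl (Or.inr ⟨by omega, rfl⟩)⟩

theorem IndexAdj.symm {i j : ℕ} (h : IndexAdj i j) : IndexAdj j i :=
  ⟨h.1.symm, h.2.symm⟩

/-! ### Levels along the path, and evasion of a single cop -/

/-- The distance from the copy of `H_7`, measured along the path. -/
def level {n : ℕ} (v : Fin n) : ℕ := v.val - 6

theorem level_le_of_move {n : ℕ} {u v : Fin n} (h : v = u ∨ (graphH n).Adj u v) :
    level v ≤ level u + 1 ∧ level u ≤ level v + 1 := by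
  rcases h with rfl | h
  · omega
  · have := ((graphH_adj _ _).1 h).le
    unfold level
    omega

/-- The first eight vertices contain the closed neighbourhood of H_7, so non-dominance of its
vertices is a finite check. -/
theorem exists_evading_small : ∀ (x : Fin 7) (c : Fin 8), c.val ≠ x.val →
    ∃ y : Fin 8, (y.val = x.val ∨ IndexAdj x y) ∧ y ≠ c ∧ ¬ IndexAdj c y := by
  decide

theorem exists_start_small : ∀ c : Fin 8, ∃ y : Fin 7, y.val ≠ c.val ∧ ¬ IndexAdj c y := by
  decide

/-- No vertex other than the end of the path is a corner. -/
theorem exists_evading {n : ℕ} (hn : 8 ≤ n) (x c : Fin n) (hx : x.val + 1 < n) (hc : c ≠ x) :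
    ∃ y, (y = x ∨ (graphH n).Adj x y) ∧ y ≠ c ∧ ¬ (graphH n).Adj c y := by
  by_cases hcx : (graphH n).Adj c x
  · have hle := ((graphH_adj _ _).1 hcx).le
    by_cases hx7 : x.val < 7
    · obtain ⟨y, h1, h2, h3⟩ := exists_evading_small ⟨x, hx7⟩ ⟨c, by omega⟩
        (fun h => hc (Fin.ext h))
      refine ⟨⟨y, by omega⟩, ?_, ?_, ?_⟩
      · simpa [graphH_adj, Fin.ext_iff] using h1
      · simpa [Fin.ext_iff] using h2
      · simpa [graphH_adj] using h3
    · rcases (show c.val = x.val + 1 ∨ x.val = c.val + 1 by omega) with h | h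
      · refine ⟨⟨x.val - 1, by omega⟩, Or.inr ?_, ?_, ?_⟩
        · rw [graphH_adj]
          have := (IndexAdj.succ (i := x.val - 1) (by omega)).symm
          rwa [show x.val - 1 + 1 = x.val by omega] at this
        · simp only [ne_eq, Fin.ext_iff]; omega
        · rw [graphH_adj]
          intro h'
          have := h'.le
          simp only at this
          omega
      · refine ⟨⟨x.val + 1, hx⟩, Or.inr ?_, ?_, ?_⟩
        · rw [graphH_adj]
          exact IndexAdj.succ (by omega)
        · simp only [ne_eq, Fin.ext_iff]; omega
        · rw [graphH_adj]
          intro h'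
          have := h'.le
          simp only at this
          omega
  · exact ⟨x, Or.inl rfl, hc.symm, hcx⟩

theorem exists_start {n : ℕ} (hn : 8 ≤ n) (c : Fin n) :
    ∃ y : Fin n, level y = 0 ∧ y ≠ c ∧ ¬ (graphH n).Adj c y := by
  by_cases hc : c.val < 8
  · obtain ⟨y, h1, h2⟩ := exists_start_small ⟨c, hc⟩
    refine ⟨⟨y, by omega⟩, by simp only [level]; omega, ?_, ?_⟩
    · simpa [Fin.ext_iff] using h1
    · simpa [graphH_adj] using h2
  · refine ⟨⟨0, by omega⟩, by simp [level], ?_, ?_⟩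
    · simp only [ne_eq, Fin.ext_iff]; omega
    · rw [graphH_adj]
      intro h
      have := h.le
      simp only at this
      omega

/-! ### Constructing robber plays and bounding the capture time from below -/

section General

variable {V : Type*} {G : SimpleGraph V} {k : ℕ}

/-- The robber who never moves. -/
def stationaryPlay (G : SimpleGraph V) (v : V) : RobberPlay G where
  pos _ := v
  legal _ := Or.inl rfl

/-- Every rule that prescribes legal moves from the history yields a course of play. -/
theorem exists_play (v₀ : V) (move : List V → V → V)
    (hmove : ∀ h x, move h x = x ∨ G.Adj x (move h x)) :
    ∃ ρ : RobberPlay G, ρ.pos 0 = v₀ ∧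
      ∀ t, ρ.pos (t + 1) = move (ρ.history (t + 1)) (ρ.pos t) := by
  -- The state pairs the current position with the history strictly before it.
  let st : ℕ → V × List V := fun t =>
    Nat.rec (v₀, []) (fun _ p => (move (p.1 :: p.2) p.1, p.1 :: p.2)) t
  let ρ : RobberPlay G := ⟨fun t => (st t).1, fun t => hmove _ _⟩
  have hh : ∀ t, ρ.history t = (st t).2 := by
    intro t
    induction t with
    | zero => rfl
    | succ t ih => simp only [RobberPlay.history, ih]; rfl
  refine ⟨ρ, rfl, fun t => ?_⟩
  rw [hh]

theorem RobberPlay.length_history (ρ : RobberPlay G) (t : ℕ) : (ρ.history t).length = t := by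
  induction t with
  | zero => rfl
  | succ t ih => simp [RobberPlay.history, ih]

theorem copPos_succ (σ : CopStrategy G k) (ρ : RobberPlay G) (t : ℕ) (i : Fin k) :
    copPos σ ρ (t + 1) i = copPos σ ρ t i ∨ G.Adj (copPos σ ρ t i) (copPos σ ρ (t + 1) i) :=
  σ.legal _ _ _

theorem lt_captureTime {r : ℕ}
    (H : ∀ σ : CopStrategy G k, ∃ ρ : RobberPlay G, ∀ t ≤ r, ¬ MeetAt σ ρ t) :
    ((r + 1 : ℕ) : ℕ∞) ≤ captureTime G k := by
  refine le_iInf fun σ => ?_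
  obtain ⟨ρ, hρ⟩ := H σ
  refine le_iSup_of_le ρ (le_iInf₂ fun t ht => ?_)
  have : ¬ t ≤ r := fun h => hρ t h ht
  exact_mod_cast (by omega : r + 1 ≤ t)

end General

/-! ### Lower bound for cop throttling -/

theorem level_copPos {n k : ℕ} (σ : CopStrategy (graphH n) k) (ρ : RobberPlay (graphH n))
    (t : ℕ) (i : Fin k) :
    level (copPos σ ρ t i) ≤ level (σ.pos [] i) + t ∧
      level (σ.pos [] i) ≤ level (copPos σ ρ t i) + t := by
  induction t with
  | zero => exact ⟨le_rfl, le_rfl⟩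
  | succ t ih =>
    have := level_le_of_move (copPos_succ σ ρ t i)
    omega

/-- A robber far from all the cops just waits. -/
theorem exists_play_of_uncovered {n k r : ℕ} (σ : CopStrategy (graphH n) k) (v : Fin n)
    (hv : ∀ i, level (σ.pos [] i) + r < level v ∨ level v + r < level (σ.pos [] i)) :
    ∃ ρ : RobberPlay (graphH n), ∀ t ≤ r, ¬ MeetAt σ ρ t := by
  refine ⟨stationaryPlay _ v, fun t ht hm => ?_⟩
  have key : ∀ i, copPos σ (stationaryPlay _ v) t i ≠ v := by
    intro i hi
    have h1 := level_copPos σ (stationaryPlay _ v) t i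
    rw [hi] at h1
    have := hv i
    omega
  rcases hm with ⟨i, hi⟩ | ⟨s, rfl, i, hi⟩
  · exact key i hi
  · exact key i hi

/-- A robber starting near `H_7` evades a single cop, and the other cops are too far. -/
theorem exists_play_of_single {n k r : ℕ} (hn : 8 ≤ n) (hr : 1 ≤ r) (hrn : r + 6 ≤ n)
    (σ : CopStrategy (graphH n) k) (i : Fin k)
    (hfar : ∀ j, j ≠ i → 2 * r ≤ level (σ.pos [] j)) :
    ∃ ρ : RobberPlay (graphH n), ∀ t ≤ r, ¬ MeetAt σ ρ t := by
  classical
  obtain ⟨v₀, hv₀, hne, hna⟩ := exists_start hn (σ.pos [] i)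
  let P : List (Fin n) → Fin n → Fin n → Prop := fun h x y =>
    (y = x ∨ (graphH n).Adj x y) ∧ y ≠ σ.pos h i ∧ ¬ (graphH n).Adj (σ.pos h i) y
  -- The length bound freezes the robber in round r. A last step could meet a distant cop at level
  -- r; staying put is safe, since the cops' turn in that round has already missed him.
  let move : List (Fin n) → Fin n → Fin n := fun h x =>
    if hh : h.length < r ∧ ∃ y, P h x y then hh.2.choose else x
  obtain ⟨ρ, h0, hs⟩ := exists_play (G := graphH n) v₀ move (by
    intro h x
    by_cases hh : h.length < r ∧ ∃ y, P h x y
    · simp only [move, dif_pos hh]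
      exact hh.2.choose_spec.1
    · exact Or.inl (by simp only [move, dif_neg hh]))
  have hlev : ∀ t, level (ρ.pos t) ≤ t := by
    intro t
    induction t with
    | zero => rw [h0, hv₀]
    | succ t ih =>
      have := level_le_of_move (ρ.legal t)
      omega
  have hsafe : ∀ t < r, ρ.pos t ≠ copPos σ ρ t i ∧
      ¬ (graphH n).Adj (copPos σ ρ t i) (ρ.pos t) := by
    intro t
    induction t with
    | zero =>
      intro _
      rw [h0]
      exact ⟨hne, hna⟩
    | succ t ih =>
      intro ht
      obtain ⟨h1, h2⟩ := ih (by omega)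
      have hc : copPos σ ρ (t + 1) i ≠ ρ.pos t := by
        intro h
        rcases copPos_succ σ ρ t i with h' | h'
        · exact h1 (h.symm.trans h')
        · exact h2 (h ▸ h')
      have hl := hlev t
      unfold level at hl
      have hex := exists_evading hn (ρ.pos t) (copPos σ ρ (t + 1) i) (by omega) hc
      have hh : (ρ.history (t + 1)).length < r ∧ ∃ y, P (ρ.history (t + 1)) (ρ.pos t) y :=
        ⟨by rwa [ρ.length_history], hex⟩
      rw [hs t]
      simp only [move, dif_pos hh]
      exact hh.2.choose_spec.2
  have hlast : ρ.pos r = ρ.pos (r - 1) := by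
    obtain ⟨s, rfl⟩ : ∃ s, r = s + 1 := ⟨r - 1, by omega⟩
    have hh : ¬ ((ρ.history (s + 1)).length < s + 1 ∧ ∃ y, P (ρ.history (s + 1)) (ρ.pos s) y) := by
      rw [ρ.length_history]
      exact fun h => lt_irrefl _ h.1
    rw [hs s]
    simp only [move, dif_neg hh]
    rfl
  have hafter : ∀ s < r, ∀ j, copPos σ ρ (s + 1) j ≠ ρ.pos s := by
    intro s hsr j hj
    by_cases hji : j = i
    · subst hji
      obtain ⟨h1, h2⟩ := hsafe s hsr
      rcases copPos_succ σ ρ s j with h' | h'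
      · exact h1 (hj.symm.trans h')
      · exact h2 (hj ▸ h')
    -- After the cops' turn in round s + 1 such a cop has level at least 2r - s - 1, which exceeds s
    -- because s < r.
    · have h1 := hfar j hji
      have h2 := level_copPos σ ρ (s + 1) j
      have h3 := hlev s
      rw [hj] at h2
      omega
  refine ⟨ρ, fun t ht hm => ?_⟩
  rcases hm with ⟨j, hj⟩ | ⟨s, rfl, j, hj⟩
  · rcases ht.lt_or_eq with ht | rfl
    · by_cases hji : j = i
      · subst hji
        exact (hsafe t ht).1 hj.symm
      · have h1 := hfar j hji
        have h2 := level_copPos σ ρ t j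
        have h3 := hlev t
        rw [hj] at h2
        omega
    · refine hafter (t - 1) (by omega) j ?_
      rw [← hlast, ← hj, Nat.sub_add_cancel hr]
  · exact hafter s ht j hj

/-- If two cops start close to `H_7`, then the others do not suffice for the path. -/
theorem exists_uncovered {k r M : ℕ} (hr : 1 ≤ r) (l : Fin k → ℕ)
    (hM : (k - 1) * (2 * r + 1) + r ≤ M + 1) {i j : Fin k} (hij : i ≠ j)
    (hi : l i < 2 * r) (hj : l j < 2 * r) :
    ∃ m, 3 * r ≤ m ∧ m ≤ M ∧ ∀ c, l c + r < m ∨ m + r < l c := by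
  classical
  by_contra! hcon
  let S : Finset (Fin k) := (Finset.univ.erase i).erase j
  have hS : S.card = k - 2 := by
    rw [Finset.card_erase_of_mem (by simp [hij.symm]), Finset.card_erase_of_mem (by simp)]
    simp
    omega
  -- Cops `i` and `j` reach only levels below 3r within r rounds, so the others, each covering at
  -- most 2r + 1 levels, would have to cover everything from 3r on.
  have hsub : Finset.Icc (3 * r) M ⊆ S.biUnion fun c => Finset.Icc (l c - r) (l c + r) := by
    intro m hm
    rw [Finset.mem_Icc] at hm
    obtain ⟨c, h1, h2⟩ := hcon m hm.1 hm.2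
    rw [Finset.mem_biUnion]
    refine ⟨c, ?_, by rw [Finset.mem_Icc]; omega⟩
    have hci : c ≠ i := by rintro rfl; omega
    have hcj : c ≠ j := by rintro rfl; omega
    simp [S, hci, hcj]
  have h1 := Finset.card_le_card hsub
  have h2 : (S.biUnion fun c => Finset.Icc (l c - r) (l c + r)).card ≤ S.card * (2 * r + 1) :=
    Finset.card_biUnion_le_card_mul _ _ _ fun c _ => by rw [Nat.card_Icc]; omega
  rw [hS] at h2
  rw [Nat.card_Icc] at h1
  have hk : 2 ≤ k := by
    have := i.2
    have := j.2
    have : i.val ≠ j.val := fun h => hij (Fin.ext h)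
    omega
  obtain ⟨q, rfl⟩ : ∃ q, k = q + 2 := ⟨k - 2, by omega⟩
  simp only [Nat.add_sub_cancel, show q + 2 - 1 = q + 1 by omega] at h2 hM
  rw [add_mul] at hM
  omega

theorem lt_captureTime_graphH {n k r : ℕ} (hn : 8 ≤ n) (hk : 1 ≤ k) (hr : 1 ≤ r)
    (h : (k - 1) * (2 * r + 1) + r + 6 ≤ n) :
    ((r + 1 : ℕ) : ℕ∞) ≤ captureTime (graphH n) k := by
  refine lt_captureTime fun σ => ?_
  by_cases hex : ∃ i j : Fin k, i ≠ j ∧ level (σ.pos [] i) < 2 * r ∧ level (σ.pos [] j) < 2 * r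
  · obtain ⟨i, j, hij, hi, hj⟩ := hex
    obtain ⟨m, hm1, hm2, hm⟩ := exists_uncovered (M := n - 7) hr (fun c => level (σ.pos [] c))
      (by omega) hij hi hj
    have hlv : level (⟨m + 6, by omega⟩ : Fin n) = m := by simp [level]
    exact exists_play_of_uncovered σ ⟨m + 6, by omega⟩ (by rwa [hlv])
  · push Not at hex
    have hrn : r + 6 ≤ n := le_trans (by omega) h
    by_cases hi : ∃ i, level (σ.pos [] i) < 2 * r
    · obtain ⟨i, hi⟩ := hi
      exact exists_play_of_single hn hr hrn σ i fun j hj => hex i j hj.symm hi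
    · push Not at hi
      exact exists_play_of_single hn hr hrn σ ⟨0, hk⟩ fun j _ => hi j

theorem one_le_captureTime_graphH {n k : ℕ} (hk : k < n) :
    ((0 + 1 : ℕ) : ℕ∞) ≤ captureTime (graphH n) k := by
  refine lt_captureTime fun σ => ?_
  have : ¬ Function.Surjective (σ.pos []) := fun hs => by
    have := Fintype.card_le_of_surjective _ hs
    simp at this
    omega
  simp only [Function.Surjective, not_forall, not_exists] at this
  obtain ⟨v, hv⟩ := this
  refine ⟨stationaryPlay _ v, fun t ht hm => ?_⟩
  obtain rfl : t = 0 := by omega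
  rcases hm with ⟨i, hi⟩ | ⟨s, h, -⟩
  · exact hv i hi
  · omega

theorem two_mul_le_copThrottling {a n : ℕ} (ha : 3 ≤ a) (hn : n + 2 * a = 2 * a ^ 2 + 6) :
    ((2 * a : ℕ) : ℕ∞) ≤ copThrottling (graphH n) := by
  refine le_iInf₂ fun k hk => ?_
  have hk1 := hk.1
  rcases le_or_gt (2 * a) k with h | h
  · exact le_add_right (by exact_mod_cast h)
  · obtain ⟨r, hr⟩ : ∃ r, 2 * a = k + (r + 1) := ⟨2 * a - k - 1, by omega⟩
    rw [hr, Nat.cast_add]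
    refine add_le_add_right ?_ _
    -- For r = 0 it suffices that there are fewer cops than vertices.
    rcases Nat.eq_zero_or_pos r with rfl | hr0
    · exact one_le_captureTime_graphH (by nlinarith)
    · obtain ⟨q, rfl⟩ : ∃ q, k = q + 1 := ⟨k - 1, by omega⟩
      refine lt_captureTime_graphH (by nlinarith) hk1 hr0 ?_
      rw [Nat.add_sub_cancel]
      zify at hr hn ⊢
      have h1 : (n : ℤ) * 2 = (2 * a) ^ 2 - 2 * (2 * a) + 12 := by linarith
      rw [hr] at h1
      -- Here 2a = q + r + 2, and twice the inequality simplifies to 4qr ≤ (q + r)^2.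
      nlinarith [sq_nonneg ((q : ℤ) - r)]

/-! ### Upper bound for damage throttling: the chasing strategy -/

/-- The move of a cop on `p` who chases a robber on `v`: he captures the robber if he can, and
otherwise approaches a robber on the path; a cop in `H_7` leaves it only from the vertex
labelled `4`. -/
noncomputable def chaseStep {n : ℕ} (hn : 8 ≤ n) (p v : Fin n) : Fin n :=
  open Classical in
  if p = v ∨ (graphH n).Adj p v then v
  else if 7 ≤ v.val then
    if p.val = 3 then ⟨6, by omega⟩
    else if h : 6 ≤ p.val ∧ p.val < v.val then ⟨p.val + 1, by omega⟩
    else if v.val < p.val then ⟨p.val - 1, by omega⟩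
    else p
  else p

theorem chaseStep_legal {n : ℕ} (hn : 8 ≤ n) (p v : Fin n) :
    chaseStep hn p v = p ∨ (graphH n).Adj p (chaseStep hn p v) := by
  unfold chaseStep
  split_ifs with h1 h2 h3 h4 h5
  · rcases h1 with rfl | h1
    · exact Or.inl rfl
    · exact Or.inr h1
  · refine Or.inr ?_
    rw [graphH_adj, h3]
    change IndexAdj 3 6
    decide
  · refine Or.inr ?_
    rw [graphH_adj]
    exact IndexAdj.succ h4.1
  · refine Or.inr ?_
    rw [graphH_adj]
    have := (IndexAdj.succ (i := p.val - 1) (by omega)).symm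
    rwa [show p.val - 1 + 1 = p.val by omega] at this
  · exact Or.inl rfl
  · exact Or.inl rfl

theorem chaseStep_of_adj {n : ℕ} (hn : 8 ≤ n) {p v : Fin n}
    (h : p = v ∨ (graphH n).Adj p v) : chaseStep hn p v = v := by
  unfold chaseStep
  rw [if_pos h]

/-- The coordinate on the path, where the vertex labelled `4` counts as the one before the vertex
labelled `7`. -/
def coord {n : ℕ} (p : Fin n) : ℕ := if p.val = 3 then 5 else p.val

/-- Indices 3 and 5 share the coordinate 5, but a cop on index 5 does not leave H_7 in pursuit;
hence the exclusion of index 5. -/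
theorem coord_chaseStep_left {n : ℕ} (hn : 8 ≤ n) {p v : Fin n} (hv : 7 ≤ v.val)
    (hp : 5 ≤ coord p) (hp' : p.val ≠ 5) (h : coord p < v.val) :
    (chaseStep hn p v).val = coord p + 1 := by
  unfold chaseStep
  by_cases h3 : p.val = 3
  · have hc : coord p = 5 := if_pos h3
    rw [if_neg, if_pos hv, if_pos h3, hc]
    rintro (h | h)
    · rw [h] at h3; omega
    · have := ((graphH_adj _ _).1 h).le
      omega
  · have hc : coord p = p.val := if_neg h3
    rw [hc] at hp h ⊢
    by_cases ha : p = v ∨ (graphH n).Adj p v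
    · rw [if_pos ha]
      rcases ha with rfl | ha
      · omega
      · have := ((graphH_adj _ _).1 ha).le
        omega
    · rw [if_neg ha, if_pos hv, if_neg h3, dif_pos (by omega)]

theorem chaseStep_right {n : ℕ} (hn : 8 ≤ n) {p v : Fin n} (hv : 7 ≤ v.val)
    (h : v.val < p.val) : (chaseStep hn p v).val = p.val - 1 := by
  unfold chaseStep
  by_cases ha : p = v ∨ (graphH n).Adj p v
  · rw [if_pos ha]
    rcases ha with rfl | ha
    · omega
    · have := ((graphH_adj _ _).1 ha).le
      omega
  · rw [if_neg ha, if_pos hv, if_neg (by omega), dif_neg (by omega), if_pos h]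

/-- All cops chase the robber from the given initial positions. -/
noncomputable def chaseStrategy {n k : ℕ} (hn : 8 ≤ n) (base : Fin k → Fin n) :
    CopStrategy (graphH n) k where
  -- Histories list the newest position first, so the right fold replays the game from its start.
  pos h i := h.foldr (fun v p => chaseStep hn p v) (base i)
  legal _ _ _ := chaseStep_legal hn _ _

theorem copPos_chaseStrategy_succ {n k : ℕ} (hn : 8 ≤ n) (base : Fin k → Fin n)
    (ρ : RobberPlay (graphH n)) (t : ℕ) (i : Fin k) :
    copPos (chaseStrategy hn base) ρ (t + 1) i =
      chaseStep hn (copPos (chaseStrategy hn base) ρ t i) (ρ.pos t) := rfl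

theorem adj_three_small : ∀ v : Fin 7, v.val ≠ 0 → v.val ≠ 3 → IndexAdj 3 v := by
  decide

theorem not_adj_three_zero : ¬ IndexAdj 3 0 := by
  decide

/-- Against a chasing cop on the vertex labelled `4`, a robber who starts in `H_7` damages at most
the vertex on which he starts. -/
theorem damagedSet_subset_of_small {n k : ℕ} (hn : 8 ≤ n) (base : Fin k → Fin n) (i : Fin k)
    (hi : (base i).val = 3) (ρ : RobberPlay (graphH n)) (h0 : (ρ.pos 0).val ≤ 6) :
    damagedSet (chaseStrategy hn base) ρ ⊆ {ρ.pos 0} := by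
  set σ := chaseStrategy hn base
  rintro v ⟨t, rfl, ht⟩
  have hcap : ∀ s, (copPos σ ρ s i).val = 3 → (ρ.pos s).val ≤ 6 → (ρ.pos s).val ≠ 0 →
      MeetAt σ ρ s ∨ MeetAt σ ρ (s + 1) := by
    intro s hs h6 hne
    by_cases h3 : (ρ.pos s).val = 3
    · exact Or.inl (Or.inl ⟨i, Fin.ext (hs.trans h3.symm)⟩)
    · refine Or.inr (Or.inr ⟨s, rfl, i, ?_⟩)
      rw [copPos_chaseStrategy_succ]
      refine chaseStep_of_adj hn (Or.inr ?_)
      rw [graphH_adj]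
      change IndexAdj (copPos σ ρ s i).val _
      rw [hs]
      exact adj_three_small ⟨(ρ.pos s).val, by omega⟩ hne h3
  -- Leaving vertex 1 within H_7 puts the robber next to, or on, the cop at vertex 4, so an
  -- uncaptured robber stays there, and the cop waits.
  have key : ∀ s ≤ t, (copPos σ ρ s i).val = 3 ∧ (ρ.pos s).val = 0 := by
    intro s
    induction s with
    | zero =>
      intro _
      refine ⟨hi, ?_⟩
      by_contra hne
      rcases hcap 0 hi h0 hne with h | h
      · exact ht 0 (by omega) h
      · exact ht 1 (by omega) h
    | succ s ih =>
      intro hs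
      obtain ⟨h1, h2⟩ := ih (by omega)
      have h3 : (copPos σ ρ (s + 1) i).val = 3 := by
        rw [copPos_chaseStrategy_succ]
        unfold chaseStep
        rw [if_neg, if_neg (by omega)]
        · exact h1
        · rintro (h | h)
          · rw [← h] at h2
            change (copPos σ ρ s i).val = 0 at h2
            omega
          · rw [graphH_adj] at h
            change IndexAdj (copPos σ ρ s i).val _ at h
            rw [h1, h2] at h
            exact not_adj_three_zero h
      refine ⟨h3, ?_⟩
      by_contra hne
      have hle : (ρ.pos (s + 1)).val ≤ 6 := by
        rcases ρ.legal s with h | h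
        · rw [h]; omega
        · have := ((graphH_adj _ _).1 h).le
          omega
      rcases hcap (s + 1) h3 hle hne with h | h
      · exact ht (s + 1) (by omega) h
      · exact ht (s + 2) (by omega) h
  exact Fin.ext ((key t le_rfl).2.trans (key 0 (by omega)).2.symm)

/-- A robber on the path is squeezed between the chasing cops next to him. -/
theorem squeeze {n k : ℕ} (hn : 8 ≤ n) (base : Fin k → Fin n) (i : Fin k)
    (hi : 5 ≤ coord (base i)) (hi' : (base i).val ≠ 5) (ρ : RobberPlay (graphH n))
    (h7 : 7 ≤ (ρ.pos 0).val) (hlt : coord (base i) < (ρ.pos 0).val) (t : ℕ)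
    (ht : ∀ s ≤ t, ¬ MeetAt (chaseStrategy hn base) ρ s) :
    7 ≤ (ρ.pos t).val ∧ (copPos (chaseStrategy hn base) ρ t i).val ≠ 5 ∧
      coord (copPos (chaseStrategy hn base) ρ t i) = coord (base i) + t ∧
      coord (base i) + t < (ρ.pos t).val ∧
      ∀ j, (ρ.pos 0).val < (base j).val →
        (copPos (chaseStrategy hn base) ρ t j).val + t = (base j).val ∧
        (ρ.pos t).val + t < (base j).val := by
  set σ := chaseStrategy hn base
  induction t with
  | zero => exact ⟨h7, hi', rfl, hlt, fun j hj => ⟨rfl, hj⟩⟩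
  | succ t ih =>
    obtain ⟨h1, h2, h3, h4, h5⟩ := ih fun s hs => ht s (by omega)
    have hno := ht (t + 1) le_rfl
    have hno1 : ∀ j, (copPos σ ρ (t + 1) j).val ≠ (ρ.pos (t + 1)).val :=
      fun j hj => hno (Or.inl ⟨j, Fin.ext hj⟩)
    have hno2 : ∀ j, (copPos σ ρ (t + 1) j).val ≠ (ρ.pos t).val :=
      fun j hj => hno (Or.inr ⟨t, rfl, j, Fin.ext hj⟩)
    have hmove : (ρ.pos (t + 1)).val ≤ (ρ.pos t).val + 1 ∧
        (ρ.pos t).val ≤ (ρ.pos (t + 1)).val + 1 := by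
      rcases ρ.legal t with h | h
      · rw [h]; omega
      · have := ((graphH_adj _ _).1 h).le
        omega
    have hl : (copPos σ ρ (t + 1) i).val = coord (base i) + (t + 1) := by
      rw [copPos_chaseStrategy_succ, coord_chaseStep_left hn h1 (by rw [h3]; omega) h2 (by omega),
        h3]
      rfl
    have hne1 := hno1 i
    have hne2 := hno2 i
    -- The cop advances by one each round and cannot pass the robber: neither the robber's old
    -- vertex nor his new one may coincide with the cop's.
    have hlt' : coord (base i) + (t + 1) < (ρ.pos (t + 1)).val := by omega
    refine ⟨by omega, by omega, ?_, hlt', fun j hj => ?_⟩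
    · rw [coord, if_neg (by omega), hl]
    · obtain ⟨h6, h8⟩ := h5 j hj
      have hr : (copPos σ ρ (t + 1) j).val = (copPos σ ρ t j).val - 1 := by
        rw [copPos_chaseStrategy_succ, chaseStep_right hn h1 (by change _ < (copPos σ ρ t j).val; omega)]
      have hne3 := hno1 j
      have hne4 := hno2 j
      omega

theorem damageNumber_graphH_le {a n : ℕ} (ha : 3 ≤ a) (hn : n + 2 * a = 2 * a ^ 2 + 6) :
    damageNumber (graphH n) a ≤ ((a - 2 : ℕ) : ℕ∞) := by
  obtain ⟨r, rfl⟩ : ∃ r, a = r + 1 := ⟨a - 1, by omega⟩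
  have hn8 : 8 ≤ n := by nlinarith
  -- With a = r + 1 the hypothesis reads n = 2r^2 + 2r + 6, which is equality for i = r.
  have hbound : ∀ i ≤ r, 5 + i * (2 * r + 1) + r + 1 ≤ n := by
    intro i hi
    have := Nat.mul_le_mul_right (2 * r + 1) hi
    nlinarith
  let base : Fin (r + 1) → Fin n := fun i =>
    if i.val = 0 then ⟨3, by omega⟩
    else ⟨5 + i.val * (2 * r + 1), by have := hbound i.val (by omega); omega⟩
  have hbase : ∀ i, i.val ≠ 0 → (base i).val = 5 + i.val * (2 * r + 1) := by
    intro i hi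
    simp only [base, if_neg hi]
  have hbase0 : ∀ i, i.val = 0 → (base i).val = 3 := by
    intro i hi
    simp only [base, if_pos hi]
  have hpos : ∀ i : ℕ, i ≠ 0 → 2 * r + 1 ≤ i * (2 * r + 1) := fun i hi =>
    Nat.le_mul_of_pos_left _ (Nat.pos_of_ne_zero hi)
  have hcoord : ∀ i, coord (base i) = 5 + i.val * (2 * r + 1) := by
    intro i
    by_cases hi : i.val = 0
    · rw [coord, if_pos (hbase0 i hi), hi, zero_mul, add_zero]
    · have := hbase i hi
      have := hpos _ hi
      rw [coord, if_neg (by omega)]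
      assumption
  refine iInf_le_of_le (chaseStrategy hn8 base) (iSup_le fun ρ => ?_)
  rcases le_or_gt (ρ.pos 0).val 6 with h6 | h6
  · refine (Set.encard_le_encard (damagedSet_subset_of_small hn8 base 0 (hbase0 0 rfl) ρ h6)).trans
      ?_
    rw [Set.encard_singleton]
    -- This is where a ≥ 3 is needed: one damaged vertex must be within the budget a - 2.
    exact_mod_cast (by omega : 1 ≤ r + 1 - 2)
  · set v := (ρ.pos 0).val with hv
    -- Coordinates of the cops are 5 + i(2r + 1), so the quotient picks the last cop whose
    -- coordinate is at most v.
    obtain ⟨i, hi⟩ : ∃ i, i = (v - 5) / (2 * r + 1) := ⟨_, rfl⟩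
    have hdiv := Nat.div_add_mod (v - 5) (2 * r + 1)
    have hmod := Nat.mod_lt (v - 5) (show 2 * r + 1 > 0 by omega)
    rw [← hi, mul_comm] at hdiv
    have hir : i < r + 1 := by
      rw [hi]
      refine Nat.div_lt_of_lt_mul ?_
      have := (ρ.pos 0).2
      have : v + 2 * (r + 1) < 2 * (r + 1) ^ 2 + 6 := by omega
      have : 5 ≤ v := by omega
      zify [this]
      zify at *
      nlinarith
    have hdam : damagedSet (chaseStrategy hn8 base) ρ ⊆
        ↑((Finset.range (r + 1 - 2)).image ρ.pos) := by
      rintro w ⟨t, rfl, ht⟩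
      simp only [Finset.coe_image, Finset.coe_range]
      refine Set.mem_image_of_mem _ ?_
      rw [Set.mem_Iio]
      have hne : coord (base ⟨i, hir⟩) ≠ v := by
        intro h
        refine ht 0 (by omega) (Or.inl ⟨⟨i, hir⟩, Fin.ext ?_⟩)
        change (base ⟨i, hir⟩).val = v
        rw [← h]
        unfold coord at h ⊢
        split_ifs at h ⊢ <;> omega
      have hc := hcoord ⟨i, hir⟩
      simp only at hc
      have h5 : (base ⟨i, hir⟩).val ≠ 5 := by
        by_cases h0 : i = 0
        · rw [hbase0 _ h0]; omega
        · rw [hbase _ h0]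
          have := hpos i h0
          simp only
          omega
      obtain ⟨-, -, -, h1, h2⟩ := squeeze hn8 base ⟨i, hir⟩ (by omega) h5 ρ h6 (by omega) (t + 1) ht
      -- Surviving round t + 1 leaves room for t + 1 steps of the cop on the left, and on the right
      -- either for as many steps of the next cop or for the end of the path r vertices away. Either
      -- way t < r - 1.
      by_cases hlast : i = r
      · have := (ρ.pos (t + 1)).2
        have : n = 5 + i * (2 * r + 1) + r + 1 := by
          rw [hlast]; nlinarith
        omega
      · have hs : (i + 1) * (2 * r + 1) = i * (2 * r + 1) + (2 * r + 1) := by ring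
        have hb := hbase ⟨i + 1, by omega⟩ (Nat.succ_ne_zero i)
        simp only at hb
        have := (h2 ⟨i + 1, by omega⟩ (by omega)).2
        omega
    refine (Set.encard_le_encard hdam).trans ?_
    rw [Set.encard_coe_eq_coe_finsetCard]
    exact_mod_cast Finset.card_image_le.trans (Finset.card_range _).le

theorem damageThrottling_le {a n : ℕ} (ha : 3 ≤ a) (hn : n + 2 * a = 2 * a ^ 2 + 6) :
    damageThrottling (graphH n) ≤ ((2 * a - 2 : ℕ) : ℕ∞) := by
  have han : a ≤ n := by nlinarith
  refine iInf₂_le_of_le a ⟨by omega, by simpa using han⟩ ?_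
  rw [show 2 * a - 2 = a + (a - 2) by omega, Nat.cast_add]
  exact add_le_add_right (damageNumber_graphH_le ha hn) _

end CopsRobbers

theorem mainTheorem10 (a n : ℕ) (ha : 3 ≤ a) (hn : (n : ℤ) = 2 * (a : ℤ) ^ 2 - 2 * a + 6) :
    CopsRobbers.damageThrottling (CopsRobbers.graphH n) <
      CopsRobbers.copThrottling (CopsRobbers.graphH n) - 1 := by
  have hn' : n + 2 * a = 2 * a ^ 2 + 6 := by
    zify
    linarith
  refine (CopsRobbers.damageThrottling_le ha hn').trans_lt ?_
  refine lt_of_lt_of_le ?_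
    (tsub_le_tsub_right (CopsRobbers.two_mul_le_copThrottling ha hn') 1)
  exact_mod_cast (by omega : 2 * a - 2 < 2 * a - 1)
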